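/- Let $n\ge 1$ and let $\mathbb V=(V_1,\dots,V_n)$ be an $n$-tuple of commuting isometries on a complex Hilbert space $\mathcal H$. A closed subspace is $\mathbb V$-invariant if it is invariant under every $V_i$, and $\mathbb V$-reducing if it is invariant under every $V_i$ and every $V_i^*$. Suppose that $\mathbb V$ is completely non-unitary: there is no non-zero $\mathbb V$-reducing subspace $\mathcal K$ such that $V_i|\mathcal K$ is unitary for all $i=1,\dots,n$. Let $\mathrm{Ann}(\mathbb V)=\{p\in\mathbb C[X_1,\dots,X_n] : p(V_1,\dots,V_n)=0\}$, and let $\mathcal I\subseteq\mathrm{Ann}(\mathbb V)$ be an ideal of $\mathbb C[X_1,\dots,X_n]$ whose variety $Z(\mathcal I)=\{z\in\mathbb C^n : p(z)=0 \text{ for all } p\in\mathcal I\}$ has dimension $1$. If $\mathcal I$ is radical, its prime factors are the unique finitely many prime ideals $\mathcal I_1,\dots,\mathcal I_m$ with $\bigcap_{i}\mathcal I_i=\mathcal I$ and $\bigcap_{i\ne j}\mathcal I_i\supsetneq\mathcal I$ for $j=1,\dots,m$ (the intersection of the empty family being $\mathbb C[X_1,\dots,X_n]$). 1. $\mathcal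 I=\mathrm{Ann}(\mathbb V)$ if and only if $\mathcal I$ is radical and its prime factors $\mathcal I_1,\dots,\mathcal I_m$ satisfy $\bigcap_{i\neq j}\mathcal I_i\nsubseteq\mathrm{Ann}(\mathbb V)$ for every $j\in\{1,\dots,m\}$. 2. If $\mathcal I=\mathrm{Ann}(\mathbb V)$, with prime factors $\mathcal I_1,\dots,\mathcal I_m$, then there exist non-zero, mutually orthogonal, $\mathbb V$-invariant closed subspaces $\mathcal H_1,\dots,\mathcal H_m$ of $\mathcal H$ such that $\mathrm{Ann}(\mathbb V|\mathcal H_j)=\mathcal I_j$ for each $j\in\{1,\dots,m\}$, where $\mathbb V|\mathcal H_j=(V_1|\mathcal H_j,\dots,V_n|\mathcal H_j)$. -/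

import Mathlib

/-- An `n`-tuple `(V₁, …, Vₙ)` of commuting linear isometries of an inner product space. -/
structure CommIsometries (n : ℕ) (H : Type*) [NormedAddCommGroup H] [InnerProductSpace ℂ H] where
  op : Fin n → H →L[ℂ] H
  commute : ∀ i j, Commute (op i) (op j)
  isometry : ∀ i, Isometry (op i)

namespace CommIsometries

variable {n : ℕ} {H : Type*} [NormedAddCommGroup H] [InnerProductSpace ℂ H]

theorem pairwise_commute (V : CommIsometries n H) (α : Fin n →₀ ℕ) :
    ((Finset.univ : Finset (Fin n)) : Set (Fin n)).Pairwise
      (Function.onFun Commute fun i => V.op i ^ α i) :=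
  fun i _ j _ _ => (V.commute i j).pow_pow (α i) (α j)

/-- The multi-index power `V ^ α = V₁ ^ α₁ ⋯ Vₙ ^ αₙ`. -/
noncomputable def multiPow (V : CommIsometries n H) (α : Fin n →₀ ℕ) : H →L[ℂ] H :=
  (Finset.univ : Finset (Fin n)).noncommProd (fun i => V.op i ^ α i) (V.pairwise_commute α)

theorem multiPow_zero (V : CommIsometries n H) : V.multiPow 0 = 1 := by
  rw [multiPow, Finset.noncommProd_eq_pow_card _ _ _ 1 (fun i _ => by simp), one_pow]

theorem multiPow_add (V : CommIsometries n H) (α β : Fin n →₀ ℕ) :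
    V.multiPow (α + β) = V.multiPow α * V.multiPow β := by
  have h := Finset.noncommProd_mul_distrib (s := (Finset.univ : Finset (Fin n)))
    (fun i => V.op i ^ α i) (fun i => V.op i ^ β i) (V.pairwise_commute α) (V.pairwise_commute β)
    (fun i _ j _ _ => (V.commute i j).pow_pow _ _)
  rw [multiPow, multiPow, multiPow, ← h]
  exact Finset.noncommProd_congr rfl (fun i _ => by simp [pow_add]) _

theorem multiPow_single (V : CommIsometries n H) (i : Fin n) :
    V.multiPow (Finsupp.single i 1) = V.op i := by
  have h := Finset.noncommProd_erase_mul (Finset.univ : Finset (Fin n)) (Finset.mem_univ i)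
    (fun j => V.op j ^ (Finsupp.single i 1 : Fin n →₀ ℕ) j)
    (V.pairwise_commute (Finsupp.single i 1))
  refine h.symm.trans ?_
  refine (congrArg₂ (· * ·) (Finset.noncommProd_eq_pow_card _ _ _ 1 ?_) rfl).trans ?_
  · intro j hj
    simp [(Finset.ne_of_mem_erase hj).symm]
  · simp

/-- Multi-index powers as a monoid homomorphism in the exponent. -/
noncomputable def powHom (V : CommIsometries n H) :
    Multiplicative (Fin n →₀ ℕ) →* (H →L[ℂ] H) where
  toFun α := V.multiPow α.toAdd
  map_one' := V.multiPow_zero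
  map_mul' α β := V.multiPow_add α.toAdd β.toAdd

/-- Polynomial evaluation `p ↦ p(V)`: `∑ c_α X ^ α` is sent to `∑ c_α V ^ α`. -/
noncomputable def eval (V : CommIsometries n H) :
    MvPolynomial (Fin n) ℂ →ₐ[ℂ] (H →L[ℂ] H) :=
  AddMonoidAlgebra.lift ℂ (H →L[ℂ] H) (Fin n →₀ ℕ) V.powHom

theorem eval_monomial (V : CommIsometries n H) (α : Fin n →₀ ℕ) (c : ℂ) :
    V.eval (MvPolynomial.monomial α c) = c • V.multiPow α :=
  AddMonoidAlgebra.lift_single _ _ _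

theorem eval_X (V : CommIsometries n H) (i : Fin n) :
    V.eval (MvPolynomial.X i) = V.op i := by
  rw [MvPolynomial.X, eval_monomial, one_smul, multiPow_single]

/-- The annihilator `Ann(V)`: the ideal of all polynomials `p` with `p(V) = 0`. -/
noncomputable def Ann (V : CommIsometries n H) : Ideal (MvPolynomial (Fin n) ℂ) :=
  RingHom.ker V.eval

/-- `K` is invariant under every member of the tuple. -/
def Invariant (V : CommIsometries n H) (K : Submodule ℂ H) : Prop :=
  ∀ i, ∀ x ∈ K, V.op i x ∈ K

/-- `K` is invariant under every member of the tuple and under its adjoint. -/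
def Reducing [CompleteSpace H] (V : CommIsometries n H) (K : Submodule ℂ H) : Prop :=
  V.Invariant K ∧ ∀ i, ∀ x ∈ K, (ContinuousLinearMap.adjoint (V.op i)) x ∈ K

/-- The restriction `V|K = (V₁|K, …, Vₙ|K)` to an invariant subspace. -/
noncomputable def restrict (V : CommIsometries n H) (K : Submodule ℂ H) (hK : V.Invariant K) :
    CommIsometries n K where
  op i := (V.op i).restrict (hK i)
  commute i j := by
    ext x
    exact congrArg (fun T : H →L[ℂ] H => T x) (V.commute i j).eq
  isometry i := fun x y => V.isometry i x y

/-- Every member of the tuple is a unitary operator, that is, a surjective linear isometry. -/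
def IsUnitary (V : CommIsometries n H) : Prop :=
  ∀ i, ∃ U : H ≃ₗᵢ[ℂ] H, ∀ x, U x = V.op i x

/-- The only closed reducing subspace on which all members of the tuple are unitary is `0`. -/
def CompletelyNonUnitary [CompleteSpace H] (V : CommIsometries n H) : Prop :=
  ∀ (K : Submodule ℂ H) (hK : V.Reducing K), IsClosed (K : Set H) →
    (V.restrict K hK.1).IsUnitary → K = ⊥

end CommIsometries

/-- The dimension of an affine algebraic set `Z ⊆ ℂⁿ`: the Krull dimension of its coordinate ring
`ℂ[X₁, …, Xₙ] / I(Z)`, where `I(Z)` is the ideal of polynomials vanishing on `Z`. -/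
noncomputable def varietyDim {n : ℕ} (Z : Set (Fin n → ℂ)) : WithBot ℕ∞ :=
  ringKrullDim (MvPolynomial (Fin n) ℂ ⧸ MvPolynomial.vanishingIdeal ℂ Z)

/-- `P₁, …, Pₘ` are the prime factors of `I`: they are prime ideals, their intersection is `I`,
and no `Pⱼ` can be omitted, the intersection of the others being strictly larger than `I`.
(The intersection of the empty family is the unit ideal.) -/
def IsPrimeFactors {R : Type*} [CommRing R] (I : Ideal R) {m : ℕ} (P : Fin m → Ideal R) : Prop :=
  (∀ j, (P j).IsPrime) ∧ ⨅ j, P j = I ∧ ∀ j, I < ⨅ i, ⨅ _ : i ≠ j, P i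

/-! ### Operator theory: orthogonality of kernels and ranges, joint eigenvectors. -/

namespace CommIsometries

variable {n : ℕ} {H : Type*} [NormedAddCommGroup H] [InnerProductSpace ℂ H]

/-! Each `p(V)` behaves like a normal operator in one respect: its kernel is orthogonal to its range
(`inner_eval_eq_zero`). Hence `Ann(V)` is radical, and closed ranges of polynomials with product in
`Ann(V)` are orthogonal; these ranges provide the subspaces of the second assertion. Complete
non-unitarity excludes joint eigenvectors, so by the Nullstellensatz no maximal ideal kills a
non-zero vector. In dimension one, a prime that contains a prime factor and annihilates a non-zero
vector must then equal that factor, which forces `Ann(V)` into every prime factor detected by `V`.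
-/

theorem eval_mul_apply (V : CommIsometries n H) (p q : MvPolynomial (Fin n) ℂ) (x : H) :
    V.eval (p * q) x = V.eval p (V.eval q x) := by
  rw [map_mul]; rfl

theorem eval_C_apply (V : CommIsometries n H) (a : ℂ) (x : H) :
    V.eval (MvPolynomial.C a) x = a • x := by
  rw [← MvPolynomial.algebraMap_eq, AlgHom.commutes]; rfl

theorem mem_Ann (V : CommIsometries n H) {p : MvPolynomial (Fin n) ℂ} :
    p ∈ V.Ann ↔ ∀ x, V.eval p x = 0 := by
  rw [Ann, RingHom.mem_ker]
  exact ⟨fun h x => by rw [h]; rfl, fun h => ContinuousLinearMap.ext h⟩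

theorem norm_op (V : CommIsometries n H) (i : Fin n) (x : H) : ‖V.op i x‖ = ‖x‖ :=
  (AddMonoidHomClass.isometry_iff_norm (V.op i)).1 (V.isometry i) x

theorem inner_op (V : CommIsometries n H) (i : Fin n) (x y : H) :
    inner ℂ (V.op i x) (V.op i y) = inner ℂ x y :=
  (LinearMap.norm_map_iff_inner_map_map (V.op i)).1 (V.norm_op i) x y

theorem eval_restrict (V : CommIsometries n H) (K : Submodule ℂ H) (hK : V.Invariant K)
    (p : MvPolynomial (Fin n) ℂ) (x : K) :
    (((V.restrict K hK).eval p x : K) : H) = V.eval p x := by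
  induction p using MvPolynomial.induction_on generalizing x with
  | C a => simp only [eval_C_apply, Submodule.coe_smul]
  | add p q hp hq => simp [hp, hq]
  | mul_X p i hp => rw [eval_mul_apply, eval_mul_apply, hp, eval_X, eval_X]; rfl

/-- Up to an isometric polynomial `w(V)`, the adjoint of `p(V)` is itself a polynomial in `V`. -/
theorem exists_eval_adjoint (V : CommIsometries n H) (p : MvPolynomial (Fin n) ℂ) :
    ∃ q w : MvPolynomial (Fin n) ℂ,
      (∀ y z, inner ℂ (V.eval w y) (V.eval w z) = inner ℂ y z) ∧
      ∀ y z, inner ℂ (V.eval q y) (V.eval w z) = inner ℂ y (V.eval p z) := by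
  induction p using MvPolynomial.induction_on with
  | C a =>
    refine ⟨MvPolynomial.C (starRingEnd ℂ a), 1, fun y z => by simp, fun y z => ?_⟩
    rw [eval_C_apply, eval_C_apply, inner_smul_left, inner_smul_right, map_one, Complex.conj_conj]
    rfl
  | add p₁ p₂ h₁ h₂ =>
    obtain ⟨q₁, w₁, hw₁, hq₁⟩ := h₁
    obtain ⟨q₂, w₂, hw₂, hq₂⟩ := h₂
    -- The identity sought is `q(V)* w(V) = p(V)`; the two terms are brought to the common
    -- "denominator" `w₁ * w₂`.
    refine ⟨w₂ * q₁ + w₁ * q₂, w₁ * w₂, fun y z => ?_, fun y z => ?_⟩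
    · rw [eval_mul_apply, eval_mul_apply, hw₁, hw₂]
    · rw [map_add, map_add, add_apply, add_apply,
        inner_add_left, inner_add_right, eval_mul_apply V w₁ q₂, eval_mul_apply V w₁ w₂, hw₁, hq₂,
        ← eval_mul_apply, mul_comm w₁ w₂, eval_mul_apply, eval_mul_apply, hw₂, hq₁]
  | mul_X p i h =>
    obtain ⟨q, w, hw, hq⟩ := h
    refine ⟨q, w * MvPolynomial.X i, fun y z => ?_, fun y z => ?_⟩
    · rw [eval_mul_apply, eval_mul_apply, hw, eval_X, inner_op]
    · rw [eval_mul_apply, hq, eval_mul_apply]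

/-- The kernel of `p(V)` is orthogonal to its range. -/
theorem inner_eval_eq_zero (V : CommIsometries n H) {p : MvPolynomial (Fin n) ℂ} {y : H}
    (hy : V.eval p y = 0) (z : H) : inner ℂ y (V.eval p z) = 0 := by
  obtain ⟨q, w, hw, hq⟩ := V.exists_eval_adjoint p
  -- The kernel of `p(V)` lies in that of `q(V)`: `‖q(V)y‖² = ⟨q(V)w(V)y, w(V)q(V)y⟩ = ⟨w(V)y,
  -- p(V)q(V)y⟩ = 0`.
  have h : V.eval q y = 0 := by
    have hwq : V.eval w (V.eval q y) = V.eval q (V.eval w y) := by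
      rw [← eval_mul_apply, mul_comm, eval_mul_apply]
    have hpq : V.eval p (V.eval q y) = 0 := by
      rw [← eval_mul_apply, mul_comm, eval_mul_apply, hy, map_zero]
    rw [← inner_self_eq_zero (𝕜 := ℂ), ← hw]
    nth_rw 1 [hwq]
    rw [hq, hpq, inner_zero_right]
  rw [← hq, h, inner_zero_left]

/-- If `p(V)² = 0`, then `p(V)x` lies in both the kernel and the range of `p(V)`, so it is
orthogonal to itself. -/
theorem isRadical_Ann (V : CommIsometries n H) : V.Ann.IsRadical := by
  rw [Ideal.isRadical_iff_pow_one_lt 2 one_lt_two]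
  intro p hp
  rw [mem_Ann] at hp ⊢
  intro x
  rw [← inner_self_eq_zero (𝕜 := ℂ)]
  refine V.inner_eval_eq_zero ?_ x
  rw [← eval_mul_apply, ← sq, hp]

/-- The closure of the range of `p(V)`. -/
noncomputable def closedRange (V : CommIsometries n H) (p : MvPolynomial (Fin n) ℂ) :
    Submodule ℂ H :=
  (LinearMap.range (V.eval p : H →ₗ[ℂ] H)).topologicalClosure

theorem eval_mem_closedRange (V : CommIsometries n H) (p : MvPolynomial (Fin n) ℂ) (x : H) :
    V.eval p x ∈ V.closedRange p :=
  Submodule.le_topologicalClosure _ ⟨x, rfl⟩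

theorem closedRange_le (V : CommIsometries n H) {p : MvPolynomial (Fin n) ℂ} {K : Submodule ℂ H}
    (hK : IsClosed (K : Set H)) (h : ∀ x, V.eval p x ∈ K) : V.closedRange p ≤ K :=
  Submodule.topologicalClosure_minimal _ (by rintro _ ⟨x, rfl⟩; exact h x) hK

theorem invariant_closedRange (V : CommIsometries n H) (p : MvPolynomial (Fin n) ℂ) :
    V.Invariant (V.closedRange p) := by
  intro i
  have h : V.closedRange p ≤ (V.closedRange p).comap (V.op i : H →ₗ[ℂ] H) := by
    refine V.closedRange_le ?_ fun x => ?_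
    · exact (Submodule.isClosed_topologicalClosure _).preimage (V.op i).continuous
    · have := V.eval_mem_closedRange p (V.op i x)
      rwa [← V.eval_X, ← eval_mul_apply, mul_comm, eval_mul_apply, V.eval_X] at this
  exact fun x hx => h hx

theorem mem_Ann_restrict_closedRange (V : CommIsometries n H) (p f : MvPolynomial (Fin n) ℂ) :
    f ∈ (V.restrict _ (V.invariant_closedRange p)).Ann ↔ f * p ∈ V.Ann := by
  rw [mem_Ann, mem_Ann]
  constructor
  · intro h x
    rw [eval_mul_apply]
    have := congrArg Subtype.val (h ⟨_, V.eval_mem_closedRange p x⟩)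
    rwa [eval_restrict] at this
  · intro h x
    have hle : V.closedRange p ≤ LinearMap.ker (V.eval f : H →ₗ[ℂ] H) :=
      V.closedRange_le (V.eval f).isClosed_ker fun x => by
        rw [LinearMap.mem_ker]; exact (V.eval_mul_apply f p x).symm.trans (h x)
    apply Subtype.ext
    rw [eval_restrict]
    exact hle x.2

/-- The range of `p(V)` lies in the kernel of `q(V)`, which is orthogonal to the range of `q(V)`. -/
theorem closedRange_isOrtho (V : CommIsometries n H) {p q : MvPolynomial (Fin n) ℂ}
    (h : q * p ∈ V.Ann) : V.closedRange p ⟂ V.closedRange q := by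
  rw [mem_Ann] at h
  refine V.closedRange_le (Submodule.isClosed_orthogonal _) fun x => ?_
  have hle : V.closedRange q ≤ (Submodule.span ℂ {V.eval p x})ᗮ := by
    refine V.closedRange_le (Submodule.isClosed_orthogonal _) fun z => ?_
    rw [Submodule.mem_orthogonal_singleton_iff_inner_right]
    exact V.inner_eval_eq_zero ((V.eval_mul_apply q p x).symm.trans (h x)) z
  rw [Submodule.mem_orthogonal']
  exact fun u hu => Submodule.mem_orthogonal_singleton_iff_inner_right.1 (hle hu)

/-- A completely non-unitary tuple of commuting isometries has no joint eigenvector. -/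
theorem CompletelyNonUnitary.eq_zero_of_eigenvector [CompleteSpace H] {V : CommIsometries n H}
    (hV : V.CompletelyNonUnitary) (z : Fin n → ℂ) {y : H} (h : ∀ i, V.op i y = z i • y) :
    y = 0 := by
  by_contra hy
  have hz : ∀ i, z i ≠ 0 := fun i hi => hy <| by
    have := V.norm_op i y
    rwa [h, hi, zero_smul, norm_zero, eq_comm, norm_eq_zero] at this
  have hadj : ∀ i x, ContinuousLinearMap.adjoint (V.op i) (V.op i x) = x := fun i x =>
    ext_inner_right ℂ fun v => by
      rw [ContinuousLinearMap.adjoint_inner_left, inner_op]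
  have hadj' : ∀ i, ContinuousLinearMap.adjoint (V.op i) y = (z i)⁻¹ • y := fun i => by
    have := hadj i y
    rw [h, map_smul] at this
    rw [eq_inv_smul_iff₀ (hz i), this]
  -- `y` is an eigenvector of the adjoints too, so its line is reducing, and the tuple is unitary
  -- there.
  have hred : V.Reducing (Submodule.span ℂ {y}) := by
    constructor
    · intro i x hx
      obtain ⟨a, rfl⟩ := Submodule.mem_span_singleton.1 hx
      rw [map_smul, h]
      exact Submodule.smul_mem _ _ (Submodule.smul_mem _ _ (Submodule.mem_span_singleton_self y))
    · intro i x hx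
      obtain ⟨a, rfl⟩ := Submodule.mem_span_singleton.1 hx
      rw [map_smul, hadj']
      exact Submodule.smul_mem _ _ (Submodule.smul_mem _ _ (Submodule.mem_span_singleton_self y))
  have hbot := hV _ hred (Submodule.closed_of_finiteDimensional _) fun i => by
    refine ⟨LinearIsometryEquiv.ofSurjective
      ⟨((V.restrict _ hred.1).op i : _ →ₗ[ℂ] _), (V.restrict _ hred.1).norm_op i⟩ ?_, fun x => rfl⟩
    rintro ⟨x, hx⟩
    refine ⟨(z i)⁻¹ • ⟨x, hx⟩, Subtype.ext ?_⟩
    obtain ⟨a, rfl⟩ := Submodule.mem_span_singleton.1 hx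
    change V.op i ((z i)⁻¹ • a • y) = a • y
    rw [map_smul, map_smul, h, smul_comm a, inv_smul_smul₀ (hz i)]
  exact hy (Submodule.span_singleton_eq_bot.1 hbot)

/-- Polynomials act on `H` through `p ↦ p(V)`. -/
noncomputable abbrev evalModule (V : CommIsometries n H) : Module (MvPolynomial (Fin n) ℂ) H :=
  Module.compHom H V.eval.toRingHom

/-- A maximal ideal does not annihilate a non-zero vector of a completely non-unitary tuple. -/
theorem CompletelyNonUnitary.not_isMaximal [CompleteSpace H] {V : CommIsometries n H}
    (hV : V.CompletelyNonUnitary) {Q : Ideal (MvPolynomial (Fin n) ℂ)} {y : H} (hy : y ≠ 0)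
    (hQ : ∀ f ∈ Q, V.eval f y = 0) : ¬ Q.IsMaximal := by
  intro hmax
  obtain ⟨z, rfl⟩ := MvPolynomial.isMaximal_iff_eq_vanishingIdeal_singleton.1 hmax
  refine hy (hV.eq_zero_of_eigenvector z fun i => ?_)
  have := hQ (MvPolynomial.X i - MvPolynomial.C (z i)) <| by
    rw [MvPolynomial.mem_vanishingIdeal_singleton_iff]; simp
  rwa [map_sub, sub_apply, eval_X, eval_C_apply, sub_eq_zero] at this

/-- The annihilator of a non-zero vector lies in a non-maximal prime ideal containing `Ann(V)`. -/
theorem CompletelyNonUnitary.exists_isPrime [CompleteSpace H] {V : CommIsometries n H}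
    (hV : V.CompletelyNonUnitary) {x : H} (hx : x ≠ 0) :
    ∃ Q : Ideal (MvPolynomial (Fin n) ℂ), Q.IsPrime ∧ ¬ Q.IsMaximal ∧ V.Ann ≤ Q ∧
      ∀ f, V.eval f x = 0 → f ∈ Q := by
  -- Noetherianity enlarges the annihilator of `x` to an associated prime of `H`, the annihilator of
  -- some vector `y`.
  let := V.evalModule
  obtain ⟨Q, hQ, hle⟩ := exists_le_isAssociatedPrime_of_isNoetherianRing
    (MvPolynomial (Fin n) ℂ) x hx
  obtain ⟨hprime, y, hy⟩ := isAssociatedPrime_iff.1 hQ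
  have hmem : ∀ f, f ∈ Q ↔ V.eval f y = 0 := fun f => by
    rw [hy, Submodule.mem_colon_singleton]; rfl
  refine ⟨Q, hprime, hV.not_isMaximal (y := y) ?_ fun f => (hmem f).1, fun f hf => ?_,
    fun f hf => hle (Submodule.mem_colon_singleton.2 hf)⟩
  · rintro rfl
    exact hprime.ne_top ((Ideal.eq_top_iff_one _).2 ((hmem 1).2 (map_zero _)))
  · exact (hmem f).2 (V.mem_Ann.1 hf y)

end CommIsometries

/-! ### Commutative algebra of primes and radical ideals. -/

/-- Over an ideal whose variety has dimension one, distinct comparable primes have a maximal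
larger member. -/
theorem isMaximal_of_lt_of_varietyDim_eq_one {n : ℕ} {I P Q : Ideal (MvPolynomial (Fin n) ℂ)}
    (hdim : varietyDim (MvPolynomial.zeroLocus ℂ I) = 1) (hP : P.IsPrime) (hQ : Q.IsPrime)
    (hI : I ≤ P) (hPQ : P < Q) : Q.IsMaximal := by
  rw [varietyDim, MvPolynomial.vanishingIdeal_zeroLocus_eq_radical, ringKrullDim_quotient] at hdim
  have hle : I.radical ≤ P := hP.radical_le_iff.2 hI
  let p : PrimeSpectrum.zeroLocus (I.radical : Set (MvPolynomial (Fin n) ℂ)) := ⟨⟨P, hP⟩, hle⟩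
  let q : PrimeSpectrum.zeroLocus (I.radical : Set (MvPolynomial (Fin n) ℂ)) :=
    ⟨⟨Q, hQ⟩, hle.trans hPQ.le⟩
  -- In Krull dimension at most one every prime over `I.radical` is minimal or maximal there; `P <
  -- Q` excludes minimality.
  rcases Order.krullDim_le_one_iff.1 hdim.le q with h | h
  · exact absurd (h (show p ≤ q from hPQ.le)) hPQ.not_ge
  · obtain ⟨M, hM, hQM⟩ := Q.exists_le_maximal hQ.ne_top
    have : M ≤ Q := h (b := ⟨⟨M, hM.isPrime⟩, (hle.trans hPQ.le).trans hQM⟩) hQM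
    exact le_antisymm hQM this ▸ hM

/-- A radical ideal of a Noetherian ring has prime factors. -/
theorem exists_isPrimeFactors {R : Type*} [CommRing R] [IsNoetherianRing R] {I : Ideal R}
    (hI : I.IsRadical) : ∃ (m : ℕ) (P : Fin m → Ideal R), IsPrimeFactors I P := by
  have hfin : Finite I.minimalPrimes := I.finite_minimalPrimes_of_isNoetherianRing R
  obtain ⟨m, ⟨e⟩⟩ := Finite.exists_equiv_fin I.minimalPrimes
  have hinf : ⨅ j, ((e.symm j : I.minimalPrimes) : Ideal R) = I := by
    rw [e.symm.iInf_comp (g := fun P : I.minimalPrimes => (P : Ideal R)), ← sInf_eq_iInf',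
      Ideal.sInf_minimalPrimes, hI.radical]
  refine ⟨m, fun j => (e.symm j : I.minimalPrimes), fun j => (e.symm j).2.1.1, hinf,
    fun j => lt_of_le_not_ge ?_ fun h => ?_⟩
  · exact le_iInf₂ fun i _ => hinf.ge.trans (iInf_le _ i)
  · have hle : (Finset.univ.erase j).inf (fun i => ((e.symm i : I.minimalPrimes) : Ideal R)) ≤
        (e.symm j : I.minimalPrimes) := by
      refine le_trans ?_ (h.trans (e.symm j).2.1.2)
      exact le_iInf₂ fun i hi => Finset.inf_le (by simpa using hi)
    obtain ⟨i, hi, hij⟩ := (e.symm j).2.1.1.inf_le'.1 hle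
    refine Finset.ne_of_mem_erase hi (e.symm.injective (Subtype.ext (le_antisymm hij ?_)))
    exact (e.symm j).2.2 (e.symm i).2.1 hij

/-! ### The two assertions. -/

namespace CommIsometries

variable {n : ℕ} {H : Type*} [NormedAddCommGroup H] [InnerProductSpace ℂ H]

theorem CompletelyNonUnitary.eq_Ann_of_isPrimeFactors [CompleteSpace H] {V : CommIsometries n H}
    (hV : V.CompletelyNonUnitary) {I : Ideal (MvPolynomial (Fin n) ℂ)} (hI : I ≤ V.Ann)
    (hdim : varietyDim (MvPolynomial.zeroLocus ℂ I) = 1) {m : ℕ}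
    {P : Fin m → Ideal (MvPolynomial (Fin n) ℂ)} (hP : IsPrimeFactors I P)
    (hAnn : ∀ j, ¬ (⨅ i, ⨅ _ : i ≠ j, P i) ≤ V.Ann) : I = V.Ann := by
  refine le_antisymm hI ?_
  rw [← hP.2.1]
  refine le_iInf fun j => ?_
  obtain ⟨p, hp, hpA⟩ := SetLike.not_le_iff_exists.1 (hAnn j)
  rw [mem_Ann, not_forall] at hpA
  obtain ⟨x, hx⟩ := hpA
  obtain ⟨Q, hQ, hmax, hAQ, hxQ⟩ := hV.exists_isPrime hx
  -- `P j` kills `p(V)x`, since multiplying `P j` by `p`, an element of all the other factors, lands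
  -- in `I`.
  have hPQ : P j ≤ Q := fun f hf => hxQ f <| by
    rw [← eval_mul_apply]
    refine V.mem_Ann.1 (hI ?_) x
    rw [← hP.2.1, Submodule.mem_iInf]
    intro i
    by_cases hij : i = j
    · exact hij ▸ (P j).mul_mem_right p hf
    · exact (P i).mul_mem_left f (iInf₂_le (f := fun i (_ : i ≠ j) => P i) i hij hp)
  rcases hPQ.eq_or_lt with h | h
  · exact h ▸ hAQ
  · exact absurd (isMaximal_of_lt_of_varietyDim_eq_one hdim (hP.1 j) hQ
      (hP.2.1.ge.trans (iInf_le _ j)) h) hmax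

/-- Take `p j` in every factor except `P j` and let `K j` be the closure of the range of `p j (V)`.
For `i ≠ j` the product `p i * p j` lies in all factors, whence orthogonality; the annihilator on `K
j` is the colon ideal of `Ann(V)` by `p j`, which is `P j` by primality. -/
theorem exists_orthogonal_of_isPrimeFactors (V : CommIsometries n H) {m : ℕ}
    {P : Fin m → Ideal (MvPolynomial (Fin n) ℂ)} (hP : IsPrimeFactors V.Ann P) :
    ∃ (K : Fin m → Submodule ℂ H) (hK : ∀ j, V.Invariant (K j)),
      (∀ j, IsClosed (K j : Set H)) ∧ (∀ j, K j ≠ ⊥) ∧ (∀ i j, i ≠ j → K i ⟂ K j) ∧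
      ∀ j, (V.restrict (K j) (hK j)).Ann = P j := by
  have hmem : ∀ f, f ∈ V.Ann ↔ ∀ j, f ∈ P j := fun f => by rw [← hP.2.1, Submodule.mem_iInf]
  choose p hp hpA using fun j => SetLike.exists_of_lt (hP.2.2 j)
  have hpP : ∀ i j, i ≠ j → p j ∈ P i := fun i j hij =>
    iInf₂_le (f := fun i (_ : i ≠ j) => P i) i hij (hp j)
  have hpj : ∀ j, p j ∉ P j := fun j h => hpA j <| (hmem _).2 fun i => by
    by_cases hij : i = j
    · exact hij ▸ h
    · exact hpP i j hij
  refine ⟨fun j => V.closedRange (p j), fun j => V.invariant_closedRange (p j),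
    fun j => Submodule.isClosed_topologicalClosure _, fun j h => hpA j ?_, fun i j hij => ?_,
    fun j => ?_⟩
  · refine V.mem_Ann.2 fun x => ?_
    have : V.eval (p j) x ∈ V.closedRange (p j) := V.eval_mem_closedRange (p j) x
    rwa [show V.closedRange (p j) = ⊥ from h, Submodule.mem_bot] at this
  · refine V.closedRange_isOrtho ((hmem _).2 fun k => ?_)
    by_cases hkj : k = j
    · exact (P k).mul_mem_left _ (hpP k i (hkj ▸ hij.symm))
    · exact (P k).mul_mem_right _ (hpP k j hkj)
  · ext f
    rw [mem_Ann_restrict_closedRange, hmem]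
    constructor
    · intro h
      exact ((hP.1 j).mem_or_mem (h j)).resolve_right (hpj j)
    · intro h i
      by_cases hij : i = j
      · exact (P i).mul_mem_right _ (hij ▸ h)
      · exact (P i).mul_mem_left _ (hpP i j hij)

end CommIsometries

theorem theorem3p5 {n : ℕ} {H : Type*} [NormedAddCommGroup H] [InnerProductSpace ℂ H]
    [CompleteSpace H] (V : CommIsometries n H) (hV : V.CompletelyNonUnitary)
    (I : Ideal (MvPolynomial (Fin n) ℂ)) (hI : I ≤ V.Ann)
    (hdim : varietyDim (MvPolynomial.zeroLocus ℂ I) = 1) :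
    (I = V.Ann ↔
      I.IsRadical ∧ ∃ (m : ℕ) (P : Fin m → Ideal (MvPolynomial (Fin n) ℂ)),
        IsPrimeFactors I P ∧ ∀ j, ¬ (⨅ i, ⨅ _ : i ≠ j, P i) ≤ V.Ann) ∧
    (I = V.Ann →
      ∀ (m : ℕ) (P : Fin m → Ideal (MvPolynomial (Fin n) ℂ)), IsPrimeFactors I P →
        ∃ (K : Fin m → Submodule ℂ H) (hK : ∀ j, V.Invariant (K j)),
          (∀ j, IsClosed (K j : Set H)) ∧ (∀ j, K j ≠ ⊥) ∧ (∀ i j, i ≠ j → K i ⟂ K j) ∧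
          ∀ j, (V.restrict (K j) (hK j)).Ann = P j) := by

  refine ⟨⟨fun h => ?_, fun ⟨_, m, P, hP, hAnn⟩ => hV.eq_Ann_of_isPrimeFactors hI hdim hP hAnn⟩,
    fun h m P hP => V.exists_orthogonal_of_isPrimeFactors (h ▸ hP)⟩
  have hrad : I.IsRadical := h ▸ V.isRadical_Ann
  obtain ⟨m, P, hP⟩ := exists_isPrimeFactors hrad
  exact ⟨hrad, m, P, hP, fun j => h ▸ (hP.2.2 j).not_ge⟩
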